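/- Let $p$ be an odd prime, let $\mathbb{F}_p$ be the field with $p$ elements, and let $\chi$ be the quadratic character of $\mathbb{F}_p$ (the Legendre symbol $\left(\frac{\cdot}{p}\right)$, with $\chi(0)=0$). For $c\in\mathbb{F}_p$ consider the $(p-1)\times(p-1)$ matrix over $\mathbb{F}_p$ $$D_p(c)=\left[(i^2+cij+j^2)^{p-2}\right]_{1\le i,j\le p-1}.$$ Then the following hold. 1. If $p\neq 3$ and $c=\pm 2$, then $\det D_p(c)=0$. 2. If $\chi(c^2-4)=1$, then there exists $x\in\mathbb{F}_p$ such that $$\det D_p(c)=(-1)^{(p-1)/2}\,\chi(c+2)\cdot x^2.$$ 3. If $\chi(c^2-4)=-1$, then there exists $x\in\mathbb{F}_p$ such that $$\det D_p(c)=(-1)^{(p-1)/2}\,\chi(c+2)\cdot 2c\cdot x^2.$$ -/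

import Mathlib

/-- The matrix `D_p(c,d) = [(i² + c i j + d j²)^(p-2)]`, `1 ≤ i, j ≤ p-1`, over `𝔽_p = ZMod p`.
The index `i : Fin (p - 1)` stands for the integer `i + 1`. -/
def matrixD (p : ℕ) (c d : ZMod p) : Matrix (Fin (p - 1)) (Fin (p - 1)) (ZMod p) :=
  Matrix.of fun i j =>
    (((i.val + 1 : ℕ) : ZMod p) ^ 2
      + c * ((i.val + 1 : ℕ) : ZMod p) * ((j.val + 1 : ℕ) : ZMod p)
      + d * ((j.val + 1 : ℕ) : ZMod p) ^ 2) ^ (p - 2)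

/-- The matrix `D_p(c) = D_p(c,1)`. -/
def matrixD₁ (p : ℕ) (c : ZMod p) : Matrix (Fin (p - 1)) (Fin (p - 1)) (ZMod p) :=
  matrixD p c 1

/-! Since `x ^ (p - 2) = x⁻¹`, the entry at units `a, b` is `a⁻¹ b⁻¹ g(a/b)` with `g(t) = (t + t⁻¹ +
c)⁻¹`: a rescaled group matrix of `𝔽_pˣ`. Its determinant is the product of `λ_k = ∑ t^k g(t)`, `0 ≤
k < p - 1`. As `g(t⁻¹) = g(t)`, `λ_k = λ_{p-1-k}`, so modulo squares only `λ_0 λ_n` remains, `n =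
(p-1)/2`. Both are evaluated by grouping `t` by the value `u` of `t + t⁻¹ + c`: the weight of a
fibre is a polynomial in `u` by Euler's criterion, and `sum_eval_mul_inv` reads off its linear
coefficient. -/

open Finset Polynomial

/-! ### Character sums over a finite field, and group determinants. -/

section FiniteField

variable {F : Type*} [Field F] [Fintype F]

/-- Summing a polynomial of degree less than `q` against `u⁻¹` extracts its linear coefficient. -/
theorem sum_eval_mul_inv (hq : 2 < Fintype.card F) (P : F[X])
    (hP : P.natDegree < Fintype.card F) :
    ∑ u : F, P.eval u * u⁻¹ = -P.coeff 1 := by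
  classical
  have key : ∀ i ∈ range (Fintype.card F),
      ∑ u : F, P.coeff i * u ^ i * u⁻¹ = if i = 1 then -P.coeff 1 else 0 := by
    intro i hi
    rw [mem_range] at hi
    simp_rw [mul_assoc, ← mul_sum]
    rcases i with _ | i
    · have h : ∑ u : F, u⁻¹ = ∑ u : F, u ^ 1 := by
        simpa using Equiv.sum_comp (Equiv.inv F) (fun u : F => u)
      simp only [pow_zero, one_mul]
      rw [h, FiniteField.sum_pow_lt_card_sub_one F 1 (by omega)]
      simp
    -- The correction at `u = 0` matters only for `i = 0`, where `0 ^ 0 = 1` but `0 * 0⁻¹ = 0`; it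
    -- yields the `-1`.
    · have h : ∀ u : F, u ^ (i + 1) * u⁻¹ = u ^ i - if u = 0 then (0 : F) ^ i else 0 := by
        intro u
        rcases eq_or_ne u 0 with rfl | hu
        · simp
        · simp [hu, pow_succ]
      simp_rw [h]
      rw [sum_sub_distrib, FiniteField.sum_pow_lt_card_sub_one F i (by omega)]
      rcases i with _ | i <;> simp
  simp_rw [eval_eq_sum_range' hP, sum_mul]
  rw [sum_comm, sum_congr rfl key]
  simp [show 1 < Fintype.card F by omega]

theorem card_eq_two_mul_half_add_one (hF : ringChar F ≠ 2) :
    Fintype.card F = 2 * (Fintype.card F / 2) + 1 := by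
  have := FiniteField.odd_card_of_char_ne_two hF
  omega

theorem two_mul_half_card (hF : ringChar F ≠ 2) : 2 * ((Fintype.card F / 2 : ℕ) : F) = -1 := by
  have h : ((2 * (Fintype.card F / 2) + 1 : ℕ) : F) = 0 := by
    rw [← card_eq_two_mul_half_add_one hF, FiniteField.cast_card_eq_zero]
  push_cast at h
  linear_combination h

theorem two_lt_card (hF : ringChar F ≠ 2) : 2 < Fintype.card F := by
  have := card_eq_two_mul_half_add_one hF
  have := Fintype.one_lt_card (α := F)
  omega

variable [DecidableEq F]

/-- The equation is `t² - s t + 1 = 0`; `t ↦ 2t - s` sends its roots to the square roots of the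
discriminant. -/
theorem card_units_add_inv_eq (hF : ringChar F ≠ 2) (s : F) :
    (#{t : Fˣ | (t : F) + (t : F)⁻¹ = s} : ℤ) = quadraticChar F (s ^ 2 - 4) + 1 := by
  have h2 : (2 : F) ≠ 0 := Ring.two_ne_zero hF
  rw [← quadraticChar_card_sqrts hF]
  congr 1
  refine card_bij (fun t _ => 2 * (t : F) - s) ?_ ?_ ?_
  · intro t ht
    have ht0 : (t : F) ≠ 0 := t.ne_zero
    simp only [mem_filter, mem_univ, true_and] at ht
    simp only [Set.mem_toFinset, Set.mem_ofPred_eq]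
    rw [← ht]
    field_simp
    ring
  · intro a _ b _ h
    exact Units.ext (mul_left_cancel₀ h2 (by linear_combination h))
  · intro x hx
    simp only [Set.mem_toFinset, Set.mem_ofPred_eq] at hx
    have hprod : (x + s) / 2 * ((s - x) / 2) = 1 := by
      field_simp
      linear_combination -hx
    refine ⟨⟨(x + s) / 2, (s - x) / 2, hprod, by rw [mul_comm, hprod]⟩, ?_, ?_⟩
    · simp only [mem_filter, mem_univ, true_and]
      rw [inv_eq_of_mul_eq_one_right hprod]
      field_simp
      ring
    · simp only
      field_simp
      ring

/-- On the fibre `(s + 2) t = (t + 1)²`, so the character is constant there unless `s = -2`, when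
the fibre is `{-1}`. -/
theorem sum_quadraticChar_units_add_inv_eq (hF : ringChar F ≠ 2) (s : F) :
    ∑ t ∈ univ.filter fun t : Fˣ => (t : F) + (t : F)⁻¹ = s, quadraticChar F (t : F)
      = quadraticChar F (s + 2) + quadraticChar F (s - 2) := by
  have h2 : (2 : F) ≠ 0 := Ring.two_ne_zero hF
  rcases eq_or_ne (s + 2) 0 with hs | hs
  · have h : (univ.filter fun t : Fˣ => (t : F) + (t : F)⁻¹ = s) = {-1} := by
      ext t
      have ht0 : (t : F) ≠ 0 := t.ne_zero
      simp only [mem_filter, mem_univ, true_and, mem_singleton]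
      rw [eq_neg_of_add_eq_zero_left hs, Units.ext_iff]
      constructor
      · intro h
        field_simp at h
        have : ((t : F) + 1) ^ 2 = 0 := by linear_combination h
        simpa using eq_neg_of_add_eq_zero_left (pow_eq_zero_iff two_ne_zero |>.mp this)
      · rintro h
        rw [h]
        norm_num
    have hs2 : s - 2 = -1 * 2 ^ 2 := by linear_combination hs
    rw [h, sum_singleton, hs, hs2, map_mul, quadraticChar_sq_one' h2]
    simp
  · have h : ∀ t ∈ univ.filter fun t : Fˣ => (t : F) + (t : F)⁻¹ = s,
        quadraticChar F (t : F) = quadraticChar F (s + 2) := by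
      intro t ht
      have ht0 : (t : F) ≠ 0 := t.ne_zero
      simp only [mem_filter, mem_univ, true_and] at ht
      have hprod : (s + 2) * t = ((t : F) + 1) ^ 2 := by
        rw [← ht]
        field_simp
        ring
      have ht1 : (t : F) + 1 ≠ 0 := fun h => by
        rw [h] at hprod
        simp [hs] at hprod
      have hχ := quadraticChar_sq_one' ht1
      rw [← hprod, map_mul] at hχ
      rcases quadraticChar_dichotomy hs with h | h <;> rw [h] at hχ ⊢ <;> linarith
    rw [sum_congr rfl h, sum_const, nsmul_eq_mul, card_units_add_inv_eq hF,
      show s ^ 2 - 4 = (s + 2) * (s - 2) by ring, map_mul]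
    linear_combination quadraticChar F (s - 2) * quadraticChar_sq_one hs

theorem sum_units_fiberwise_add_inv (w : Fˣ → ℤ) (c : F) :
    ∑ t : Fˣ, (w t : F) * ((t : F) + (t : F)⁻¹ + c)⁻¹
      = ∑ u : F, ((∑ t ∈ univ.filter fun t : Fˣ => (t : F) + (t : F)⁻¹ = u - c, w t : ℤ) : F) * u⁻¹ := by
  rw [← sum_fiberwise univ (fun t : Fˣ => (t : F) + (t : F)⁻¹ + c)]
  refine sum_congr rfl fun u _ => ?_
  push_cast
  rw [sum_mul]
  simp_rw [eq_sub_iff_add_eq]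
  refine sum_congr rfl fun t ht => ?_
  rw [(mem_filter.mp ht).2]

theorem sum_units_inv_add_inv_add (hF : ringChar F ≠ 2) (c : F) :
    ∑ t : Fˣ, ((t : F) + (t : F)⁻¹ + c)⁻¹
      = -(c * (c ^ 2 - 4) ^ (Fintype.card F / 2 - 1)) := by
  set n := Fintype.card F / 2 with hn
  have hq := two_lt_card hF
  have hcard := card_eq_two_mul_half_add_one hF
  rw [← hn] at hcard
  have h := sum_units_fiberwise_add_inv (fun _ => 1) c
  simp only [Int.cast_one, one_mul, sum_const, nsmul_eq_mul, mul_one] at h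
  rw [h]
  simp_rw [card_units_add_inv_eq hF]
  -- The fibre size as a polynomial in `u`. Its linear coefficient is `P'(0)`, simplified by `2n =
  -- -1` in `F`.
  let P : F[X] := ((X - C c) ^ 2 - 4) ^ n + 1
  have hP : P.natDegree < Fintype.card F := by
    have : P.natDegree ≤ n * 2 := by
      dsimp only [P]
      compute_degree
    omega
  have hcoeff : P.coeff 1 = c * (c ^ 2 - 4) ^ (n - 1) := by
    have h1 : P.coeff 1 = (derivative P).eval 0 := by
      rw [← coeff_zero_eq_eval_zero, coeff_derivative]
      simp
    rw [h1]
    have hd : (derivative P).eval 0 = n * (c ^ 2 - 4) ^ (n - 1) * (2 * -c) := by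
      simp [P, derivative_pow]
    rw [hd]
    linear_combination (-c * (c ^ 2 - 4) ^ (n - 1)) * two_mul_half_card hF
  rw [← hcoeff, ← sum_eval_mul_inv hq P hP]
  refine sum_congr rfl fun u _ => ?_
  congr 1
  push_cast
  rw [quadraticChar_eq_pow_of_char_ne_two' hF]
  simp [P, ← hn]

theorem sum_units_pow_half_mul_inv_add_inv_add (hF : ringChar F ≠ 2) (c : F) :
    ∑ t : Fˣ, (t : F) ^ (Fintype.card F / 2) * ((t : F) + (t : F)⁻¹ + c)⁻¹
      = -((Fintype.card F / 2 : ℕ) * ((2 - c) ^ (Fintype.card F / 2 - 1)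
          + (-2 - c) ^ (Fintype.card F / 2 - 1))) := by
  set n := Fintype.card F / 2 with hn
  have hq := two_lt_card hF
  have hcard := card_eq_two_mul_half_add_one hF
  rw [← hn] at hcard
  have h := sum_units_fiberwise_add_inv (fun t => quadraticChar F (t : F)) c
  simp_rw [quadraticChar_eq_pow_of_char_ne_two' hF, ← hn] at h
  rw [h]
  simp_rw [sum_quadraticChar_units_add_inv_eq hF]
  let P : F[X] := (X + C (2 - c)) ^ n + (X + C (-2 - c)) ^ n
  have hP : P.natDegree < Fintype.card F := by
    have : P.natDegree ≤ n := by
      dsimp only [P]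
      compute_degree
    omega
  have hcoeff : P.coeff 1 = n * ((2 - c) ^ (n - 1) + (-2 - c) ^ (n - 1)) := by
    have h1 : P.coeff 1 = (derivative P).eval 0 := by
      rw [← coeff_zero_eq_eval_zero, coeff_derivative]
      simp
    rw [h1]
    simp [P, derivative_pow]
    ring
  rw [← hcoeff, ← sum_eval_mul_inv hq P hP]
  refine sum_congr rfl fun u _ => ?_
  congr 1
  push_cast
  rw [quadraticChar_eq_pow_of_char_ne_two' hF, quadraticChar_eq_pow_of_char_ne_two' hF]
  simp only [P, eval_add, eval_pow, eval_X, eval_C, ← hn]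
  ring_nf

/-- The determinant of a group matrix of `Fˣ` is the product of its character sums. -/
theorem det_units_group_matrix {m : ℕ} (v : Fin m ≃ Fˣ) (g : Fˣ → F) :
    (Matrix.of fun i j => g (v i * (v j)⁻¹)).det
      = ∏ k : Fin m, ∑ t : Fˣ, g t⁻¹ * (t : F) ^ (k : ℕ) := by
  let V : Matrix (Fin m) (Fin m) F := Matrix.vandermonde fun i => (v i : F)
  have hV : V.det ≠ 0 := Matrix.det_vandermonde_ne_zero_iff.mpr
    (Units.val_injective.comp v.injective)
  -- The Vandermonde columns are the characters `t ↦ t ^ k`, a common eigenbasis.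
  have h : (Matrix.of fun i j => g (v i * (v j)⁻¹)) * V
      = V * Matrix.diagonal fun k : Fin m => ∑ t : Fˣ, g t⁻¹ * (t : F) ^ (k : ℕ) := by
    ext i k
    rw [Matrix.mul_diagonal, Matrix.mul_apply, mul_sum,
      ← Equiv.sum_comp (v.trans (Equiv.mulLeft (v i)⁻¹))]
    refine sum_congr rfl fun j _ => ?_
    simp only [V, Matrix.of_apply, Matrix.vandermonde_apply, Equiv.trans_apply,
      Equiv.coe_mulLeft, mul_inv_rev, inv_inv, Units.val_mul, mul_pow]
    rw [mul_comm (v i), mul_left_comm, ← mul_assoc ((v i : F) ^ (k : ℕ)), ← mul_pow]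
    simp
  have hdet := congrArg Matrix.det h
  rw [Matrix.det_mul, Matrix.det_mul, Matrix.det_diagonal, mul_comm] at hdet
  exact mul_left_cancel₀ hV hdet

end FiniteField

/-- The index `n` is its own mirror image, and the partner `2n` of `0` lies outside the range. -/
theorem prod_range_two_mul_of_symm {R : Type*} [CommRing R] (f : ℕ → R) (n : ℕ) (hn : 0 < n)
    (hf : ∀ k ≤ 2 * n, f (2 * n - k) = f k) :
    ∏ k ∈ range (2 * n), f k = f 0 * f n * (∏ k ∈ range (n - 1), f (k + 1)) ^ 2 := by
  obtain ⟨m, rfl⟩ : ∃ m, n = m + 1 := ⟨n - 1, by omega⟩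
  have h : ∏ k ∈ range m, f (m + 1 + k + 1) = ∏ k ∈ range m, f (k + 1) := by
    rw [← prod_range_reflect]
    refine prod_congr rfl fun k hk => ?_
    rw [mem_range] at hk
    rw [← hf (k + 1) (by omega)]
    congr 1
    omega
  rw [show 2 * (m + 1) = (m + 1 + m) + 1 by ring, prod_range_succ', prod_range_add, h,
    prod_range_succ, Nat.add_sub_cancel]
  ring

/-! ### Reduction of the determinant to two character sums. -/

section ZMod

variable (p : ℕ) [Fact p.Prime]

/-- The enumeration `i ↦ i + 1` of the units of `ZMod p`. -/
noncomputable def finEquivUnits : Fin (p - 1) ≃ (ZMod p)ˣ :=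
  Equiv.ofBijective
    (fun i => Units.mk0 ((i.val + 1 : ℕ) : ZMod p) (by
      rw [Ne, ZMod.natCast_eq_zero_iff]
      exact Nat.not_dvd_of_pos_of_lt (by omega) (by omega)))
    (by
      rw [Fintype.bijective_iff_injective_and_card]
      refine ⟨fun i j h => ?_, by rw [ZMod.card_units, Fintype.card_fin]⟩
      have h' := congrArg Units.val h
      simp only [Units.val_mk0] at h'
      rw [ZMod.natCast_eq_natCast_iff', Nat.mod_eq_of_lt (by omega),
        Nat.mod_eq_of_lt (by omega)] at h'
      exact Fin.ext (by omega))

theorem coe_finEquivUnits (i : Fin (p - 1)) :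
    (finEquivUnits p i : ZMod p) = ((i.val + 1 : ℕ) : ZMod p) := rfl

theorem pow_prime_sub_two (hp : p ≠ 2) (x : ZMod p) : x ^ (p - 2) = x⁻¹ := by
  have hp2 := (Fact.out : p.Prime).two_le
  rcases eq_or_ne x 0 with rfl | hx
  · rw [inv_zero, zero_pow (by omega)]
  · apply eq_inv_of_mul_eq_one_left
    rw [← pow_succ, show p - 2 + 1 = p - 1 by omega, ZMod.pow_card_sub_one_eq_one hx]

theorem det_matrixD₁_eq_prod (hp : p ≠ 2) (c : ZMod p) :
    (matrixD₁ p c).det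
      = ∏ k ∈ range (p - 1),
          ∑ t : (ZMod p)ˣ, (t : ZMod p) ^ k * ((t : ZMod p) + (t : ZMod p)⁻¹ + c)⁻¹ := by
  let v := finEquivUnits p
  let g : (ZMod p)ˣ → ZMod p := fun t => ((t : ZMod p) + (t : ZMod p)⁻¹ + c)⁻¹
  have hM : matrixD₁ p c = Matrix.of fun i j => ((v i)⁻¹ : (ZMod p)ˣ).val *
      (Matrix.of fun i j => ((v j)⁻¹ : (ZMod p)ˣ).val *
        (Matrix.of fun i j => g (v i * (v j)⁻¹)) i j) i j := by
    ext i j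
    have hi : (v i : ZMod p) ≠ 0 := (v i).ne_zero
    have hj : (v j : ZMod p) ≠ 0 := (v j).ne_zero
    simp only [matrixD₁, matrixD, Matrix.of_apply, pow_prime_sub_two p hp,
      ← coe_finEquivUnits, g, Units.val_mul, Units.val_inv_eq_inv_val]
    rw [← mul_inv, ← mul_inv]
    congr 1
    change (v i : ZMod p) ^ 2 + c * v i * v j + 1 * (v j : ZMod p) ^ 2 = _
    field_simp
    ring
  -- By Wilson's theorem; the row and column scalings each give `-1` and cancel.
  have hprod : ∏ i, ((v i)⁻¹ : (ZMod p)ˣ).val = -1 := by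
    rw [← Units.coe_prod, prod_inv_distrib, Equiv.prod_comp v (fun x => x),
      FiniteField.prod_univ_units_id_eq_neg_one]
    simp
  rw [hM, Matrix.det_mul_column, Matrix.det_mul_row, hprod, det_units_group_matrix,
    ← Fin.prod_univ_eq_prod_range
      (fun k => ∑ t : (ZMod p)ˣ, (t : ZMod p) ^ k * ((t : ZMod p) + (t : ZMod p)⁻¹ + c)⁻¹)]
  rw [neg_one_mul, neg_one_mul, neg_neg]
  refine prod_congr rfl fun k _ => sum_congr rfl fun t _ => ?_
  simp only [g, Units.val_inv_eq_inv_val, inv_inv]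
  rw [mul_comm, add_comm (t : ZMod p)⁻¹]

theorem ringChar_zmod_ne_two (hp : p ≠ 2) : ringChar (ZMod p) ≠ 2 := by
  rwa [ZMod.ringChar_zmod_n]

theorem exists_det_matrixD₁_eq (hp : p ≠ 2) (c : ZMod p) :
    ∃ y : ZMod p, (matrixD₁ p c).det
      = c * (c ^ 2 - 4) ^ (p / 2 - 1)
        * ((p / 2 : ℕ) * ((2 - c) ^ (p / 2 - 1) + (-2 - c) ^ (p / 2 - 1))) * y ^ 2 := by
  have hF := ringChar_zmod_ne_two p hp
  have hp2 := (Fact.out : p.Prime).two_le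
  have hodd := card_eq_two_mul_half_add_one hF
  have h0 := sum_units_inv_add_inv_add hF c
  have h1 := sum_units_pow_half_mul_inv_add_inv_add hF c
  rw [ZMod.card] at hodd h0 h1
  rw [det_matrixD₁_eq_prod p hp, show p - 1 = 2 * (p / 2) by omega,
    prod_range_two_mul_of_symm _ _ (by omega), h1]
  · simp only [pow_zero, one_mul]
    rw [h0]
    exact ⟨_, by rw [neg_mul_neg]⟩
  · intro k hk
    rw [← Equiv.sum_comp (Equiv.inv _)]
    refine sum_congr rfl fun t _ => ?_
    have ht : (t : ZMod p) ≠ 0 := t.ne_zero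
    simp only [Equiv.inv_apply, Units.val_inv_eq_inv_val, inv_inv]
    rw [add_comm (t : ZMod p)⁻¹]
    congr 1
    rw [inv_pow]
    apply inv_eq_of_mul_eq_one_right
    rw [← pow_add, Nat.sub_add_cancel hk, show 2 * (p / 2) = p - 1 by omega,
      ZMod.pow_card_sub_one_eq_one ht]

end ZMod

theorem theorem1p1 (p : ℕ) [Fact p.Prime] (hp : p ≠ 2) (c : ZMod p) :
    (p ≠ 3 → (c = 2 ∨ c = -2) → (matrixD₁ p c).det = 0) ∧
    (quadraticChar (ZMod p) (c ^ 2 - 4) = 1 →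
      ∃ x : ZMod p, (matrixD₁ p c).det =
        (-1) ^ ((p - 1) / 2) * ((quadraticChar (ZMod p) (c + 2) : ℤ) : ZMod p) * x ^ 2) ∧
    (quadraticChar (ZMod p) (c ^ 2 - 4) = -1 →
      ∃ x : ZMod p, (matrixD₁ p c).det =
        (-1) ^ ((p - 1) / 2) * ((quadraticChar (ZMod p) (c + 2) : ℤ) : ZMod p)
          * (2 * c) * x ^ 2) := by
  have hF := ringChar_zmod_ne_two p hp
  have hp2 := (Fact.out : p.Prime).two_le
  have hodd := card_eq_two_mul_half_add_one hF
  have hhalf := two_mul_half_card hF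
  rw [ZMod.card] at hodd hhalf
  obtain ⟨y, hy⟩ := exists_det_matrixD₁_eq p hp c
  have hχ : ∀ a : ZMod p, ((quadraticChar (ZMod p) a : ℤ) : ZMod p) = a ^ (p / 2) := by
    intro a
    rw [quadraticChar_eq_pow_of_char_ne_two' hF, ZMod.card]
  rw [hχ, hy, show (p - 1) / 2 = p / 2 by omega]
  obtain ⟨m, hm⟩ : ∃ m, p / 2 = m + 1 := ⟨p / 2 - 1, by omega⟩
  have hfac : c ^ 2 - 4 = (c + 2) * (c - 2) := by ring
  rw [show (2 - c) = -1 * (c - 2) by ring, show -2 - c = -1 * (c + 2) by ring, hfac]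
  have hcast : ∀ e : ℤ, quadraticChar (ZMod p) ((c + 2) * (c - 2)) = e →
      ((c + 2) ^ (m + 1) * (c - 2) ^ (m + 1) = (e : ZMod p)) := by
    rintro e rfl
    rw [hχ, hm, mul_pow]
  simp only [hm, Nat.add_sub_cancel, mul_pow] at hhalf ⊢
  generalize ((m + 1 : ℕ) : ZMod p) = N at hhalf ⊢
  have hne : ∀ e : ℤ, e ≠ 0 → quadraticChar (ZMod p) ((c + 2) * (c - 2)) = e →
      c + 2 ≠ 0 ∧ c - 2 ≠ 0 := by
    intro e he h
    constructor <;> intro h0 <;> rw [h0] at h <;> simp at h <;> exact he h.symm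
  have hsq : c + 2 ≠ 0 → ((c + 2) ^ (m + 1)) ^ 2 = 1 := by
    intro h
    have h' := quadraticChar_sq_one h
    have h'' := congrArg (Int.cast : ℤ → ZMod p) h'
    rwa [Int.cast_pow, hχ, hm, Int.cast_one] at h''
  refine ⟨fun h3 hc => ?_, fun h => ?_, fun h => ?_⟩
  · have h0 : (c + 2) ^ m * (c - 2) ^ m = 0 := by
      -- For `p = 3` one would have `m = 0` and the vanishing factor would become `0 ^ 0 = 1`.
      have hm0 : m ≠ 0 := by omega
      rcases hc with rfl | rfl <;> simp [hm0]
    rw [h0]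
    ring
  · obtain ⟨hA, hB⟩ := hne 1 one_ne_zero h
    have hE := hsq hA
    have hAB := hcast 1 h
    push_cast at hAB
    have ha : (c + 2) ^ m = (c + 2) ^ (m + 1) / (c + 2) := by field_simp; ring
    have hb : (c - 2) ^ m = (c + 2) ^ (m + 1) / (c - 2) := by
      rw [eq_div_iff hB, ← pow_succ]
      linear_combination (c + 2) ^ (m + 1) * hAB - (c - 2) ^ (m + 1) * hE
    -- With `e = χ(c+2) = χ(c-2)`, the sum of the two `m`-th powers is `2ce/(c² - 4)` and their
    -- product `1/(c² - 4)`; then `2N = -1`.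
    refine ⟨c / ((c + 2) * (c - 2)) * y, ?_⟩
    rw [ha, hb, pow_succ (-1)]
    generalize (c + 2) ^ (m + 1) = e at *
    field_simp
    linear_combination 2 * N * c ^ 2 * e * y ^ 2 * hE
      + c ^ 2 * e * y ^ 2 * hhalf
  · obtain ⟨hA, hB⟩ := hne (-1) (by norm_num) h
    have hE := hsq hA
    have hAB := hcast (-1) h
    push_cast at hAB
    have ha : (c + 2) ^ m = (c + 2) ^ (m + 1) / (c + 2) := by field_simp; ring
    have hb : (c - 2) ^ m = -(c + 2) ^ (m + 1) / (c - 2) := by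
      rw [eq_div_iff hB, ← pow_succ]
      linear_combination (c + 2) ^ (m + 1) * hAB - (c - 2) ^ (m + 1) * hE
    -- Now `χ(c-2) = -e`, so the sum is `-4e/(c² - 4)`: its numerator has no factor `c`, and the
    -- outer `c` stays unpaired.
    refine ⟨y / ((c + 2) * (c - 2)), ?_⟩
    rw [ha, hb, pow_succ (-1)]
    generalize (c + 2) ^ (m + 1) = e at *
    field_simp
    linear_combination 4 * N * c * e * y ^ 2 * hE
      + 2 * c * e * y ^ 2 * hhalf
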